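/- An effect algebra is a set $E$ with two distinguished elements $0,1$ and a partial binary operation $+$ such that, for all $a,b,c\in E$: (i) $a+b$ is defined iff $b+a$ is defined, and then $a+b=b+a$; (ii) $a+b$ and $(a+b)+c$ are defined iff $b+c$ and $a+(b+c)$ are defined, and then $(a+b)+c=a+(b+c)$; (iii) there is a unique $a'\in E$ such that $a+a'$ is defined and equals $1$; (iv) if $a+1$ is defined, then $a=0$. Write $a\le b$ if $a+c=b$ for some $c\in E$. $E$ satisfies the Riesz decomposition property (RDP) if $x_1+x_2=y_1+y_2$ (both sums being defined) implies that there are $c_{11},c_{12},c_{21},c_{22}\in E$ with $x_1=c_{11}+c_{12}$, $x_2=c_{21}+c_{22}$, $y_1=c_{11}+c_{21}$, $y_2=c_{12}+c_{22}$. $E$ is divisible if for every integer $n\ge 1$ and every $x\in E$ there is $y\in E$ such that the $n$-fold sum $ny=y+\cdots+y$ is defined in $E$ and equals $x$. A state on $E$ is a map $s:E\to[0,1]$ with $s(1)=1$ and $s(a+b)=s(a)+s(b)$ whenever $a+b$ is defined. A state $s$ is extremal if $s=\lambda s_1+(1-\lambda)s_2$, with $s_1,s_2$ states on $E$ and $\lambda\in(0,1)$,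 implies $s=s_1=s_2$. **Proposition.** Let $E$ be a divisible effect algebra satisfying (RDP), and let $s$ be a state on $E$. Then $s$ is extremal if and only if $$\min\{s(x),s(y)\}=\sup\{s(z):\ z\in E,\ z\le x,\ z\le y\}\qquad\text{for all } x,y\in E.$$ -/

import Mathlib

/-- An effect algebra: a set with two distinguished elements `0`, `1` and a partial binary
operation `+`. The partial operation is `padd`: `padd a b = none` means that `a + b` is not
defined, and `padd a b = some c` means that `a + b` is defined and equal to `c`. -/
class EffectAlgebra (E : Type*) extends Zero E, One E where
  /-- The partial addition. -/
  padd : E → E → Option E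
  /-- `a + b` is defined iff `b + a` is defined, and then they are equal. -/
  padd_comm : ∀ a b : E, padd a b = padd b a
  /-- `a + b` and `(a + b) + c` are defined iff `b + c` and `a + (b + c)` are defined, and then
  `(a + b) + c = a + (b + c)`. -/
  padd_assoc : ∀ a b c e : E,
    (∃ d : E, padd a b = some d ∧ padd d c = some e) ↔
      ∃ f : E, padd b c = some f ∧ padd a f = some e
  /-- Every `a` has a unique orthosupplement `a'`, with `a + a' = 1`. -/
  existsUnique_compl : ∀ a : E, ∃! a' : E, padd a a' = some 1
  /-- If `a + 1` is defined, then `a = 0`. -/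
  eq_zero_of_padd_one : ∀ a b : E, padd a 1 = some b → a = 0

namespace EffectAlgebra

variable {E : Type*} [EffectAlgebra E]

/-- `a ≤ b` iff `a + c = b` for some `c`. -/
instance instLE : LE E where
  le a b := ∃ c : E, padd a c = some b

/-- The multiple `n y = y + ⋯ + y` (`n` summands), a partial operation: `none` when the sum is
not defined. -/
def pnsmul : ℕ → E → Option E
  | 0, _ => some 0
  | n + 1, y => (pnsmul n y).bind fun z => padd z y

variable (E) in
/-- The Riesz decomposition property (RDP): if `x₁ + x₂ = y₁ + y₂`, both sums being defined, then
the two decompositions have a common refinement. -/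
def RDP : Prop :=
  ∀ x₁ x₂ y₁ y₂ w : E, padd x₁ x₂ = some w → padd y₁ y₂ = some w →
    ∃ c₁₁ c₁₂ c₂₁ c₂₂ : E,
      padd c₁₁ c₁₂ = some x₁ ∧ padd c₂₁ c₂₂ = some x₂ ∧
      padd c₁₁ c₂₁ = some y₁ ∧ padd c₁₂ c₂₂ = some y₂

variable (E) in
/-- For every `x` and every integer `n ≥ 1` there is `y` such that `n y` is defined and
equal to `x`. -/
def Divisible : Prop :=
  ∀ n : ℕ, 1 ≤ n → ∀ x : E, ∃ y : E, pnsmul n y = some x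

variable (E) in
/-- The set of all states: maps `s : E → [0,1]` with `s 1 = 1` that are additive whenever the sum
is defined. -/
def stateSpace : Set (E → ℝ) :=
  {s | (∀ a, s a ∈ Set.Icc (0 : ℝ) 1) ∧ s 1 = 1 ∧
    ∀ a b c : E, padd a b = some c → s c = s a + s b}

/-- A state `s` is extremal if `s = l s₁ + (1 - l) s₂` with states `s₁`, `s₂` and `0 < l < 1`
implies `s = s₁ = s₂`. -/
def IsExtremalState (s : E → ℝ) : Prop :=
  s ∈ Set.extremePoints ℝ (stateSpace E)

end EffectAlgebra

namespace EffectAlgebra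

variable {E : Type*} [EffectAlgebra E] {a b c d e : E}

/-! If the formula holds and `s = l s₁ + m s₂`, let `s x ≤ s y`. Common lower bounds `z` of `x`, `y`
have `s z` close to `s x`, so `s₁ z` is close to `s₁ x`, while `s₁ z ≤ s₁ y`. Thus `s₁` preserves
the preorder given by `s`, and comparison with the multiples of a fraction of `1`, supplied by
divisibility, forces `s₁ = s` (`state_eq_of_monotone`).

The converse needs only (RDP). The functional `excessPart` imitates the part of `s` carried by the
band of `(y - x)⁺`, an element that need not exist; it is replaced by the downward directed family
of `h = y - z`, with `z` a common lower bound. It is additive (`excessPart_padd`) and lies between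
`0` and `s`, so extremality makes it `c s`. Let `β` be the supremum in the formula. The functional
is at most `β` on `x` and at least `s y - β` on every `h`; if `β < min (s x) (s y)`, the first bound
gives `c < 1`, and the second then fails for small `h`. -/

theorem padd_comm_some (h : padd a b = some c) : padd b a = some c := by
  rwa [padd_comm]

theorem padd_assoc_right (h₁ : padd a b = some d) (h₂ : padd d c = some e) :
    ∃ f : E, padd b c = some f ∧ padd a f = some e :=
  (padd_assoc a b c e).1 ⟨d, h₁, h₂⟩

theorem padd_assoc_left (h₁ : padd b c = some d) (h₂ : padd a d = some e) :
    ∃ f : E, padd a b = some f ∧ padd f c = some e :=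
  (padd_assoc a b c e).2 ⟨d, h₁, h₂⟩

theorem padd_zero (a : E) : padd a 0 = some a := by
  obtain ⟨o, ho, -⟩ := existsUnique_compl (1 : E)
  have h0 : o = 0 := eq_zero_of_padd_one o 1 (padd_comm_some ho)
  subst h0
  obtain ⟨a', ha', -⟩ := existsUnique_compl a
  obtain ⟨f, hf, hf'⟩ := padd_assoc_right (padd_comm_some ha') ho
  rw [hf, (existsUnique_compl a').unique hf' (padd_comm_some ha')]

theorem zero_padd (a : E) : padd 0 a = some a :=
  padd_comm_some (padd_zero a)

theorem padd_left_cancel (h₁ : padd a b = some d) (h₂ : padd a c = some d) : b = c := by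
  obtain ⟨d', hd', -⟩ := existsUnique_compl d
  obtain ⟨f, hf, hf'⟩ := padd_assoc_right (padd_comm_some h₁) hd'
  obtain ⟨g, hg, hg'⟩ := padd_assoc_right (padd_comm_some h₂) hd'
  obtain rfl : f = g := Option.some_injective _ (hf.symm.trans hg)
  exact (existsUnique_compl f).unique (padd_comm_some hf') (padd_comm_some hg')

theorem le_padd_left (h : padd a b = some c) : a ≤ c := ⟨b, h⟩

theorem le_padd_right (h : padd a b = some c) : b ≤ c := ⟨a, padd_comm_some h⟩

theorem zero_le' (a : E) : 0 ≤ a := ⟨a, zero_padd a⟩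

theorem le_one' (a : E) : a ≤ 1 := (existsUnique_compl a).exists

theorem le_trans' (h₁ : a ≤ b) (h₂ : b ≤ c) : a ≤ c := by
  obtain ⟨u, hu⟩ := h₁
  obtain ⟨v, hv⟩ := h₂
  obtain ⟨f, -, hf⟩ := padd_assoc_right hu hv
  exact ⟨f, hf⟩

/-- Addition is monotone in its second argument, as far as it is defined. -/
theorem exists_padd_le (hbc : b ≤ c) (h : padd a c = some d) :
    ∃ e : E, padd a b = some e ∧ e ≤ d := by
  obtain ⟨u, hu⟩ := hbc
  obtain ⟨f, hf, hf'⟩ := padd_assoc_left hu h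
  exact ⟨f, hf, u, hf'⟩

theorem padd_le_padd_left (hbc : b ≤ c) (h₁ : padd a b = some e) (h₂ : padd a c = some d) :
    e ≤ d := by
  obtain ⟨f, hf, hf'⟩ := exists_padd_le hbc h₂
  rwa [Option.some_injective _ (h₁.symm.trans hf)]

theorem exists_padd_le_padd {a₁ a₂ : E} (h₁ : a₁ ≤ a) (h₂ : a₂ ≤ b) (h : padd a b = some c) :
    ∃ e : E, padd a₁ a₂ = some e ∧ e ≤ c := by
  obtain ⟨f, hf, hfc⟩ := exists_padd_le h₂ h
  obtain ⟨e, he, hef⟩ := exists_padd_le h₁ (padd_comm_some hf)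
  exact ⟨e, padd_comm_some he, le_trans' hef hfc⟩

/-- Differences are antitone in the subtrahend. -/
theorem sub_le_sub_left (hab : a ≤ b) (h₁ : padd a c = some e) (h₂ : padd b d = some e) :
    d ≤ c := by
  obtain ⟨u, hu⟩ := hab
  obtain ⟨f, hf, hf'⟩ := padd_assoc_right hu h₂
  rw [padd_left_cancel h₁ hf']
  exact le_padd_right hf

/-- Under (RDP), an element below a sum is a sum of elements below the summands. -/
theorem RDP.exists_padd_of_le (hrdp : RDP E) (hd : d ≤ c) (h : padd a b = some c) :
    ∃ u v : E, padd u v = some d ∧ u ≤ a ∧ v ≤ b := by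
  obtain ⟨r, hr⟩ := hd
  obtain ⟨c₁₁, c₁₂, c₂₁, c₂₂, h₁, -, h₃, h₄⟩ := hrdp d r a b c hr h
  exact ⟨c₁₁, c₁₂, h₁, le_padd_left h₃, le_padd_left h₄⟩

/-- (RDP) implies the Riesz interpolation property. -/
theorem RDP.exists_interpolant (hrdp : RDP E) {z z' x y : E} (hzx : z ≤ x) (hzy : z ≤ y)
    (hzx' : z' ≤ x) (hzy' : z' ≤ y) : ∃ w : E, z ≤ w ∧ z' ≤ w ∧ w ≤ x ∧ w ≤ y := by
  obtain ⟨a, ha⟩ := hzx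
  obtain ⟨a', ha'⟩ := hzx'
  obtain ⟨b, hb⟩ := hzy
  obtain ⟨b', hb'⟩ := hzy'
  obtain ⟨r, p, q, t, hrp, hqt, hrq, -⟩ := hrdp z a z' a' x ha ha'
  obtain ⟨Y, hpb, hrY⟩ := padd_assoc_right hrp hb
  obtain ⟨Y', hqb, hrY'⟩ := padd_assoc_right hrq hb'
  obtain rfl := padd_left_cancel hrY hrY'
  obtain ⟨X, hpa, hrX⟩ := padd_assoc_right hrp ha
  obtain ⟨P, hpq, hPX⟩ := padd_assoc_left hqt hpa
  -- After removing `r`, the elements `p`, `q` lie below `Y = y - r`, and `p + q` lies below `X = x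
  -- - r`. Refining in `Y` gives `m = d₁₁ + d₁₂ + d₂₁`, which dominates `p` and `q` and lies below
  -- both `Y` and `p + q`; so `r + m` interpolates.
  obtain ⟨d₁₁, d₁₂, d₂₁, d₂₂, hp, hb₂, hq, -⟩ := hrdp p b q b' Y hpb hqb
  obtain ⟨m, hm, hmY⟩ := padd_assoc_left hb₂ hpb
  obtain ⟨m', hm', hmP⟩ := padd_assoc_left (padd_comm_some hq) hpq
  obtain rfl : m = m' := Option.some_injective _ (hm.symm.trans hm')
  obtain ⟨q', hq', hqm⟩ := padd_assoc_right (padd_comm_some hp) hm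
  obtain rfl : q = q' := Option.some_injective _ (hq.symm.trans hq')
  obtain ⟨w, hw, hwx⟩ :=
    exists_padd_le (le_trans' (le_padd_left hmP) (le_padd_left hPX)) hrX
  exact ⟨w, padd_le_padd_left (le_padd_left hm) hrp hw,
    padd_le_padd_left (le_padd_right hqm) hrq hw, hwx,
    padd_le_padd_left (le_padd_left hmY) hw hrY⟩

/-- `IsSumBelow h n z`: the element `z` is a sum of `n` elements, each of them below `h`. -/
def IsSumBelow (h : E) : ℕ → E → Prop
  | 0, z => z = 0
  | n + 1, z => ∃ a b : E, IsSumBelow h n a ∧ b ≤ h ∧ padd a b = some z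

theorem isSumBelow_zero (h : E) : ∀ n, IsSumBelow h n 0
  | 0 => rfl
  | n + 1 => ⟨0, 0, isSumBelow_zero h n, zero_le' h, padd_zero 0⟩

theorem isSumBelow_one {h z : E} (hz : z ≤ h) : IsSumBelow h 1 z :=
  ⟨0, z, rfl, hz, zero_padd z⟩

theorem IsSumBelow.mono {h h' z : E} {n : ℕ} (hh : h ≤ h') (hz : IsSumBelow h n z) :
    IsSumBelow h' n z := by
  induction n generalizing z with
  | zero => exact hz
  | succ n ih =>
    obtain ⟨a, b, ha, hb, hab⟩ := hz
    exact ⟨a, b, ih ha, le_trans' hb hh, hab⟩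

theorem IsSumBelow.padd {h z₁ z₂ z : E} {m n : ℕ} (h₁ : IsSumBelow h m z₁)
    (h₂ : IsSumBelow h n z₂) (hz : padd z₁ z₂ = some z) : IsSumBelow h (m + n) z := by
  induction n generalizing z₂ z with
  | zero =>
    obtain rfl : z₂ = 0 := h₂
    rwa [← Option.some_injective _ ((padd_zero z₁).symm.trans hz)]
  | succ n ih =>
    obtain ⟨a, b, ha, hb, hab⟩ := h₂
    obtain ⟨f, hf, hfz⟩ := padd_assoc_left hab hz
    exact ⟨f, b, ih ha hf, hb, hfz⟩

theorem eq_zero_of_le_zero (h : a ≤ 0) : a = 0 := by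
  obtain ⟨b, hb⟩ := h
  obtain ⟨f, hf, -⟩ := padd_assoc_right (padd_comm_some hb) (zero_padd 1)
  exact eq_zero_of_padd_one a f hf

theorem IsSumBelow.of_le (hrdp : RDP E) {h z w : E} {n : ℕ} (hz : IsSumBelow h n z)
    (hw : w ≤ z) : IsSumBelow h n w := by
  induction n generalizing z w with
  | zero =>
    obtain rfl : z = 0 := hz
    exact eq_zero_of_le_zero hw
  | succ n ih =>
    obtain ⟨a, b, ha, hb, hab⟩ := hz
    obtain ⟨u, v, huv, hu, hv⟩ := hrdp.exists_padd_of_le hw hab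
    exact ⟨u, v, ih ha hu, le_trans' hv hb, huv⟩

/-! ### States; from the supremum formula to extremality -/

section State

variable {s : E → ℝ}

theorem state_nonneg (hs : s ∈ stateSpace E) (a : E) : 0 ≤ s a := (hs.1 a).1

theorem state_padd (hs : s ∈ stateSpace E) (h : padd a b = some c) : s c = s a + s b :=
  hs.2.2 a b c h

theorem state_zero (hs : s ∈ stateSpace E) : s 0 = 0 := by
  have := state_padd hs (padd_zero (0 : E))
  linarith

theorem state_mono (hs : s ∈ stateSpace E) (h : a ≤ b) : s a ≤ s b := by
  obtain ⟨c, hc⟩ := h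
  have := state_padd hs hc
  have := state_nonneg hs c
  linarith

theorem state_pnsmul (hs : s ∈ stateSpace E) {y z : E} {n : ℕ} (h : pnsmul n y = some z) :
    s z = n * s y := by
  induction n generalizing z with
  | zero =>
    obtain rfl : (0 : E) = z := Option.some_injective _ h
    simp [state_zero hs]
  | succ n ih =>
    obtain ⟨w, hw, hwz⟩ := Option.bind_eq_some_iff.1 h
    rw [state_padd hs hwz, ih hw]
    push_cast
    ring

theorem exists_pnsmul_of_le {y z : E} {m n : ℕ} (hmn : m ≤ n) (h : pnsmul n y = some z) :
    ∃ w : E, pnsmul m y = some w := by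
  induction n generalizing z with
  | zero => exact ⟨z, by rwa [Nat.le_zero.1 hmn]⟩
  | succ n ih =>
    rcases hmn.eq_or_lt with rfl | hlt
    · exact ⟨z, h⟩
    · obtain ⟨w, hw, -⟩ := Option.bind_eq_some_iff.1 h
      exact ih (Nat.lt_succ_iff.1 hlt) hw

/-- In a divisible effect algebra, a state `s₁` that is monotone with respect to the values of a
state `s` equals `s`. -/
theorem state_eq_of_monotone (hdiv : Divisible E) {s₁ : E → ℝ} (hs : s ∈ stateSpace E)
    (hs₁ : s₁ ∈ stateSpace E) (hmono : ∀ x y, s x ≤ s y → s₁ x ≤ s₁ y) : s₁ = s := by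
  have key : ∀ (x : E) (n : ℕ), |s₁ x - s x| ≤ 1 / ((n : ℝ) + 1) := by
    intro x n
    obtain ⟨y, hy⟩ := hdiv (n + 1) (by omega) 1
    have hn : (0 : ℝ) < (n : ℝ) + 1 := by positivity
    have hval : ∀ s' ∈ stateSpace E, s' y = 1 / ((n : ℝ) + 1) := by
      intro s' hs'
      have := state_pnsmul hs' hy
      rw [hs'.2.1] at this
      push_cast at this
      rw [eq_div_iff hn.ne']
      linarith
    have hmul : ∀ k : ℕ, k ≤ n + 1 → ∃ w : E, s w = k / ((n : ℝ) + 1) ∧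
        s₁ w = k / ((n : ℝ) + 1) := by
      intro k hk
      obtain ⟨w, hw⟩ := exists_pnsmul_of_le hk hy
      refine ⟨w, ?_, ?_⟩
      · rw [state_pnsmul hs hw, hval s hs]; ring
      · rw [state_pnsmul hs₁ hw, hval s₁ hs₁]; ring
    set r : ℝ := s x * ((n : ℝ) + 1) with hr
    have hr0 : 0 ≤ r := mul_nonneg (state_nonneg hs x) hn.le
    have hr1 : r ≤ ((n + 1 : ℕ) : ℝ) := by
      push_cast
      nlinarith [(hs.1 x).2]
    have hfl : ⌊r⌋₊ ≤ n + 1 := Nat.floor_le_of_le hr1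
    obtain ⟨w, hw, hw₁⟩ := hmul _ hfl
    have hlow : ((⌊r⌋₊ : ℕ) : ℝ) / ((n : ℝ) + 1) ≤ s x := by
      rw [div_le_iff₀ hn]
      exact Nat.floor_le hr0
    have hlow₁ := hmono w x (hw.trans_le hlow)
    have hup : s x ≤ (((⌊r⌋₊ : ℕ) : ℝ) + 1) / ((n : ℝ) + 1) := by
      rw [le_div_iff₀ hn]
      exact (Nat.lt_floor_add_one r).le
    have hup₁ : s₁ x ≤ (((⌊r⌋₊ : ℕ) : ℝ) + 1) / ((n : ℝ) + 1) := by
      -- If `⌊r⌋₊ = n + 1` there is no next multiple of `y` to compare with, but then the bound is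
      -- at least `1`.
      rcases hfl.eq_or_lt with heq | hlt
      · refine (hs₁.1 x).2.trans ?_
        rw [le_div_iff₀ hn, heq]
        push_cast
        linarith
      · obtain ⟨v, hv, hv₁⟩ := hmul (⌊r⌋₊ + 1) hlt
        push_cast at hv hv₁
        rw [← hv₁]
        exact hmono x v (by rw [hv]; exact hup)
    rw [add_div] at hup hup₁
    rw [abs_le]
    constructor <;> linarith
  funext x
  by_contra hne
  obtain ⟨n, hn⟩ := exists_nat_one_div_lt (abs_pos.2 (sub_ne_zero.2 hne))
  exact absurd (key x n) (not_le.2 hn)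

theorem isExtremalState_of_isLUB (hdiv : Divisible E) (hs : s ∈ stateSpace E)
    (h : ∀ x y : E, IsLUB (s '' {z : E | z ≤ x ∧ z ≤ y}) (min (s x) (s y))) :
    IsExtremalState s := by
  refine ⟨hs, fun s₁ hs₁ s₂ hs₂ hseg => ?_⟩
  obtain ⟨l, m, hl, hm, hlm, hsum⟩ := hseg
  have hval : ∀ x, s x = l * s₁ x + m * s₂ x := by
    intro x
    rw [← hsum]
    simp
  refine state_eq_of_monotone hdiv hs hs₁ fun x y hxy => ?_
  by_contra! hlt
  have hε : 0 < l * (s₁ x - s₁ y) := mul_pos hl (sub_pos.2 hlt)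
  obtain ⟨_, ⟨z, ⟨hzx, hzy⟩, rfl⟩, hz⟩ := (lt_isLUB_iff (h x y)).1
    (show s x - l * (s₁ x - s₁ y) < min (s x) (s y) by rw [min_eq_left hxy]; linarith)
  have h₁ := state_mono hs₁ hzy
  have h₂ := state_mono hs₂ hzx
  rw [hval x, hval z] at hz
  nlinarith

/-! ### From extremality to the supremum formula -/

/-- An additive functional dominated by an extremal state is a multiple of it. -/
theorem IsExtremalState.eq_smul (hs : IsExtremalState s) {t : E → ℝ}
    (ht : ∀ a b c : E, padd a b = some c → t c = t a + t b) (ht0 : ∀ a, 0 ≤ t a)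
    (hts : ∀ a, t a ≤ s a) (x : E) : t x = t 1 * s x := by
  have hmono : ∀ f : E → ℝ, (∀ a b c : E, padd a b = some c → f c = f a + f b) →
      (∀ a, 0 ≤ f a) → ∀ a, f a ≤ f 1 := by
    intro f hf hf0 a
    obtain ⟨b, hb⟩ := le_one' a
    have := hf a b 1 hb
    have := hf0 b
    linarith
  have hstate : ∀ f : E → ℝ, (∀ a b c : E, padd a b = some c → f c = f a + f b) →
      (∀ a, 0 ≤ f a) → 0 < f 1 → (fun a => f a / f 1) ∈ stateSpace E := by
    intro f hf hf0 hf1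
    refine ⟨fun a => ⟨div_nonneg (hf0 a) hf1.le, ?_⟩, div_self hf1.ne', fun a b c h => ?_⟩
    · rw [div_le_one hf1]
      exact hmono f hf hf0 a
    · simp only [hf a b c h, add_div]
  have hu : ∀ a b c : E, padd a b = some c → s c - t c = (s a - t a) + (s b - t b) := by
    intro a b c h
    rw [ht a b c h, state_padd hs.1 h]
    ring
  have hu0 : ∀ a, 0 ≤ s a - t a := fun a => sub_nonneg.2 (hts a)
  have hs1 : s 1 = 1 := hs.1.2.1
  rcases (ht0 1).eq_or_lt with h0 | h0
  · have := hmono t ht ht0 x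
    have := ht0 x
    rw [← h0, zero_mul]
    linarith
  rcases (hu0 1).eq_or_lt with h1 | h1
  · have := hmono (fun a => s a - t a) hu hu0 x
    have := hu0 x
    have ht1 : t 1 = 1 := by linarith
    rw [ht1, one_mul]
    linarith
  -- `s = t + (s - t)` becomes a convex combination of states once both terms are normalised.
  · have key := hs.2 (hstate t ht ht0 h0) (hstate (fun a => s a - t a) hu hu0 h1)
      ⟨t 1, s 1 - t 1, h0, h1, by linarith, by
        funext a
        simp only [Pi.add_apply, Pi.smul_apply, smul_eq_mul]
        rw [mul_div_cancel₀ _ h0.ne', mul_div_cancel₀ _ h1.ne']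
        ring⟩
    have : t x / t 1 = s x := congrFun key x
    rw [← this, mul_div_cancel₀ _ h0.ne']

/-- The pairs `(z, h)` with `z ≤ x` and `z + h = y`: for them `h` is an upper bound of `0` and
`y - x`. -/
def IsExcess (x y z h : E) : Prop := z ≤ x ∧ padd z h = some y

theorem IsExcess.exists_le (hrdp : RDP E) {x y z h z' h' : E} (H : IsExcess x y z h)
    (H' : IsExcess x y z' h') : ∃ z₀ h₀ : E, IsExcess x y z₀ h₀ ∧ h₀ ≤ h ∧ h₀ ≤ h' := by
  obtain ⟨w, hzw, hzw', hwx, k, hk⟩ := hrdp.exists_interpolant H.1 (le_padd_left H.2) H'.1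
    (le_padd_left H'.2)
  exact ⟨w, k, ⟨hwx, hk⟩, sub_le_sub_left hzw H.2 hk, sub_le_sub_left hzw' H'.2 hk⟩

/-- The lower bounds of the limit over `n` of the infimum over all `h` in excess of `y - x` of
the suprema of `s` on elements below `g` that are sums of `n` elements below `h`. -/
def excessSet (s : E → ℝ) (x y g : E) : Set ℝ :=
  {r | ∃ n : ℕ, ∀ z₀ h : E, IsExcess x y z₀ h → ∃ z ≤ g, IsSumBelow h n z ∧ r ≤ s z}

/-- The part of the state `s` that is concentrated on the positive part of `y - x`. -/
noncomputable def excessPart (s : E → ℝ) (x y g : E) : ℝ := sSup (excessSet s x y g)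

theorem zero_mem_excessSet (hs : s ∈ stateSpace E) (x y g : E) : 0 ∈ excessSet s x y g :=
  ⟨0, fun _ h _ => ⟨0, zero_le' g, isSumBelow_zero h 0, (state_zero hs).ge⟩⟩

theorem le_of_mem_excessSet (hs : s ∈ stateSpace E) {x y g : E} {r : ℝ}
    (hr : r ∈ excessSet s x y g) : r ≤ s g := by
  obtain ⟨n, hn⟩ := hr
  obtain ⟨z, hz, -, hrz⟩ := hn 0 y ⟨zero_le' x, zero_padd y⟩
  exact hrz.trans (state_mono hs hz)

theorem bddAbove_excessSet (hs : s ∈ stateSpace E) (x y g : E) :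
    BddAbove (excessSet s x y g) :=
  ⟨s g, fun _ => le_of_mem_excessSet hs⟩

theorem excessPart_nonneg (hs : s ∈ stateSpace E) (x y g : E) : 0 ≤ excessPart s x y g :=
  le_csSup (bddAbove_excessSet hs x y g) (zero_mem_excessSet hs x y g)

theorem excessPart_le (hs : s ∈ stateSpace E) (x y g : E) : excessPart s x y g ≤ s g :=
  csSup_le ⟨0, zero_mem_excessSet hs x y g⟩ fun _ => le_of_mem_excessSet hs

/-- Subadditivity: nearly optimal `h₁`, `h₂` for the two summands have a common smaller `h₀`, and
(RDP) splits `z ≤ g`. Superadditivity: adding witnesses adds their numbers of summands, which is why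
`n` is unrestricted. -/
theorem excessPart_padd (hrdp : RDP E) (hs : s ∈ stateSpace E) (x y : E) {g₁ g₂ g : E}
    (hg : padd g₁ g₂ = some g) :
    excessPart s x y g = excessPart s x y g₁ + excessPart s x y g₂ := by
  apply le_antisymm
  · refine csSup_le ⟨0, zero_mem_excessSet hs x y g⟩ ?_
    rintro r ⟨n, hn⟩
    by_contra! hlt
    set ε : ℝ := (r - (excessPart s x y g₁ + excessPart s x y g₂)) / 2 with hε
    have hpos : 0 < ε := by rw [hε]; linarith
    have hnot : ∀ g' : E, ∃ z h : E, IsExcess x y z h ∧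
        ∀ w ≤ g', IsSumBelow h n w → s w < excessPart s x y g' + ε := by
      intro g'
      by_contra! hc
      have hmem : excessPart s x y g' + ε ∈ excessSet s x y g' := ⟨n, hc⟩
      have := le_csSup (bddAbove_excessSet hs x y g') hmem
      change _ ≤ excessPart s x y g' at this
      linarith
    obtain ⟨z₁, h₁, H₁, hw₁⟩ := hnot g₁
    obtain ⟨z₂, h₂, H₂, hw₂⟩ := hnot g₂
    obtain ⟨z₀, h₀, H₀, hle₁, hle₂⟩ := H₁.exists_le hrdp H₂
    obtain ⟨z, hz, hsum, hrz⟩ := hn z₀ h₀ H₀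
    obtain ⟨u, v, huv, hu, hv⟩ := hrdp.exists_padd_of_le hz hg
    have := hw₁ u hu ((hsum.of_le hrdp (le_padd_left huv)).mono hle₁)
    have := hw₂ v hv ((hsum.of_le hrdp (le_padd_right huv)).mono hle₂)
    rw [state_padd hs huv] at hrz
    linarith
  · rw [← le_sub_iff_add_le]
    refine csSup_le ⟨0, zero_mem_excessSet hs x y g₁⟩ fun r₁ hr₁ => ?_
    rw [le_sub_comm]
    refine csSup_le ⟨0, zero_mem_excessSet hs x y g₂⟩ fun r₂ hr₂ => ?_
    rw [le_sub_iff_add_le']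
    refine le_csSup (bddAbove_excessSet hs x y g) ?_
    obtain ⟨n₁, hn₁⟩ := hr₁
    obtain ⟨n₂, hn₂⟩ := hr₂
    refine ⟨n₁ + n₂, fun z₀ h H => ?_⟩
    obtain ⟨w₁, hw₁, hb₁, hr₁⟩ := hn₁ z₀ h H
    obtain ⟨w₂, hw₂, hb₂, hr₂⟩ := hn₂ z₀ h H
    obtain ⟨w, hw, hwg⟩ := exists_padd_le_padd hw₁ hw₂ hg
    refine ⟨w, hwg, hb₁.padd hb₂ hw, ?_⟩
    rw [state_padd hs hw]
    linarith

theorem state_le_of_isSumBelow (hs : s ∈ stateSpace E) {h k z : E} {ε : ℝ} {n : ℕ}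
    (hε : ∀ w : E, w ≤ h → w ≤ k → s w ≤ ε) (hz : IsSumBelow h n z) (hzk : z ≤ k) :
    s z ≤ n * ε := by
  induction n generalizing z with
  | zero =>
    obtain rfl : z = 0 := hz
    simp [state_zero hs]
  | succ n ih =>
    obtain ⟨a, b, ha, hb, hab⟩ := hz
    have h₁ := ih ha (le_trans' (le_padd_left hab) hzk)
    have h₂ := hε b hb (le_trans' (le_padd_right hab) hzk)
    rw [state_padd hs hab]
    push_cast
    linarith

/-- The excess part of `s` on `x` is bounded by the supremum of `s` on the common lower bounds
of `x` and `y`. -/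
theorem excessPart_left_le (hrdp : RDP E) (hs : s ∈ stateSpace E) {x y : E} {β : ℝ}
    (hβ : IsLUB (s '' {z : E | z ≤ x ∧ z ≤ y}) β) : excessPart s x y x ≤ β := by
  refine csSup_le ⟨0, zero_mem_excessSet hs x y x⟩ ?_
  rintro r ⟨n, hn⟩
  refine le_of_forall_pos_le_add fun δ hδ => ?_
  have hn0 : (0 : ℝ) < (n : ℝ) + 1 := by positivity
  set ε : ℝ := δ / ((n : ℝ) + 1) with hε
  have hεpos : 0 < ε := div_pos hδ hn0
  have hεδ : ((n : ℝ) + 1) * ε = δ := by rw [hε]; field_simp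
  obtain ⟨_, ⟨z₀, ⟨⟨k, hk⟩, ⟨h, hh⟩⟩, rfl⟩, hz₀⟩ := (lt_isLUB_iff hβ).1 (sub_lt_self β hεpos)
  obtain ⟨z, hzx, hsum, hrz⟩ := hn z₀ h ⟨le_padd_left hk, hh⟩
  obtain ⟨u, v, huv, hu, hv⟩ := hrdp.exists_padd_of_le hzx hk
  have hz₀β : s z₀ ≤ β := hβ.1 ⟨z₀, ⟨le_padd_left hk, le_padd_left hh⟩, rfl⟩
  -- `z₀ + w` is again a common lower bound of `x` and `y`, and `z₀` is within `ε` of optimal.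
  have hsmall : ∀ w : E, w ≤ h → w ≤ k → s w ≤ ε := by
    intro w hwh hwk
    obtain ⟨f, hf, hfx⟩ := exists_padd_le hwk hk
    have hfy := padd_le_padd_left hwh hf hh
    have hfβ : s f ≤ β := hβ.1 ⟨f, ⟨hfx, hfy⟩, rfl⟩
    rw [state_padd hs hf] at hfβ
    linarith
  have h₁ := state_le_of_isSumBelow hs hsmall (hsum.of_le hrdp (le_padd_right huv)) hv
  have h₂ := state_mono hs hu
  rw [state_padd hs huv] at hrz
  linarith

theorem le_excessPart (hrdp : RDP E) (hs : s ∈ stateSpace E) {x y z h : E} {β : ℝ}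
    (hβ : ∀ w : E, w ≤ x → w ≤ y → s w ≤ β) (H : IsExcess x y z h) :
    s y - β ≤ excessPart s x y h := by
  -- One summand suffices: `h₀` itself, below both `h` and `h'`.
  refine le_csSup (bddAbove_excessSet hs x y h) ⟨1, fun z' h' H' => ?_⟩
  obtain ⟨z₀, h₀, H₀, hle, hle'⟩ := H.exists_le hrdp H'
  refine ⟨h₀, hle, isSumBelow_one hle', ?_⟩
  have := state_padd hs H₀.2
  have := hβ z₀ H₀.1 (le_padd_left H₀.2)
  linarith

theorem IsExtremalState.isLUB (hrdp : RDP E) (hs : IsExtremalState s) (x y : E) :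
    IsLUB (s '' {z : E | z ≤ x ∧ z ≤ y}) (min (s x) (s y)) := by
  have hst : s ∈ stateSpace E := hs.1
  have hub : min (s x) (s y) ∈ upperBounds (s '' {z : E | z ≤ x ∧ z ≤ y}) := by
    rintro _ ⟨z, ⟨hzx, hzy⟩, rfl⟩
    exact le_min (state_mono hst hzx) (state_mono hst hzy)
  have hβ := isLUB_csSup (s := s '' {z : E | z ≤ x ∧ z ≤ y})
    ⟨_, 0, ⟨zero_le' x, zero_le' y⟩, rfl⟩ ⟨_, hub⟩
  set β := sSup (s '' {z : E | z ≤ x ∧ z ≤ y})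
  rcases (hβ.2 hub).eq_or_lt with heq | hlt
  · rwa [← heq]
  exfalso
  obtain ⟨hβx, hβy⟩ := lt_min_iff.1 hlt
  have hc := hs.eq_smul (t := excessPart s x y) (fun _ _ _ => excessPart_padd hrdp hst x y)
    (excessPart_nonneg hst x y) (excessPart_le hst x y)
  set c := excessPart s x y 1
  have hx : c * s x ≤ β := hc x ▸ excessPart_left_le hrdp hst hβ
  have hc0 : 0 ≤ c := excessPart_nonneg hst x y 1
  have hsx : 0 ≤ s x := state_nonneg hst x
  have hc1 : c < 1 := by
    by_contra! h
    nlinarith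
  -- With this margin, `c * s h < (1 - (1 - c)²) (s y - β)` when `c > 0`, contradicting the lower
  -- bound `s y - β ≤ c * s h`; for `c = 0` the latter fails outright.
  have hgap : 0 < (1 - c) * (s y - β) := mul_pos (by linarith) (by linarith)
  obtain ⟨_, ⟨z, ⟨hzx, ⟨h, hh⟩⟩, rfl⟩, hz⟩ := (lt_isLUB_iff hβ).1 (sub_lt_self β hgap)
  have hlow := le_excessPart hrdp hst
    (fun w hwx hwy => hβ.1 ⟨w, ⟨hwx, hwy⟩, rfl⟩) (show IsExcess x y z h from ⟨hzx, hh⟩)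
  rw [hc h] at hlow
  have hy := state_padd hst hh
  nlinarith

end State

end EffectAlgebra

theorem mainTheorem8 {E : Type*} [EffectAlgebra E]
    (hdiv : EffectAlgebra.Divisible E) (hrdp : EffectAlgebra.RDP E)
    (s : E → ℝ) (hs : s ∈ EffectAlgebra.stateSpace E) :
    EffectAlgebra.IsExtremalState s ↔
      ∀ x y : E, IsLUB (s '' {z : E | z ≤ x ∧ z ≤ y}) (min (s x) (s y)) :=
  ⟨fun h => h.isLUB hrdp, EffectAlgebra.isExtremalState_of_isLUB hdiv hs⟩
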